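/- All graphs are finite, simple and undirected. For a connected graph $G$ with vertex set $V(G)$, let $d_G(u,v)$ be the length of a shortest path between $u$ and $v$, let $D(G)=(d_G(u,v))_{u,v\in V(G)}$ be the distance matrix, and let $\mathrm{Tr}(G)$ be the diagonal matrix whose entry at $v$ is $\sum_{u\in V(G)} d_G(v,u)$. Let $\eta(G)$ denote the largest eigenvalue of the distance signless Laplacian matrix $Q(G)=\mathrm{Tr}(G)+D(G)$. A fractional matching of $G$ is a function $f:E(G)\to[0,1]$ such that $\sum_{e\ni v} f(e)\le 1$ for every vertex $v$; the fractional matching number $\mu_f(G)$ is the maximum of $\sum_{e\in E(G)} f(e)$ over all fractional matchings $f$ of $G$. Let $G_1+G_2$ denote the disjoint union, let $G_1\vee G_2$ denote the join (the disjoint union together with all edges between $V(G_1)$ and $V(G_2)$), let $K_m$ be the complete graph on $m$ vertices, and let $\overline{H}$ be the complement of $H$. **Theorem.** Let $n$ and $k$ be integers with $1\le k<n$ and $n\ge 14k+24$, and let $G$ be a connected graph of order $n$. Suppose that $$\eta(G)\le \eta\bigl(K_1\vee(K_{n-2-k}+\overline{K_{1+k}})\bigr).$$ Then $\mu_f(G)>\frac{n-k}{2}$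 if and only if $G$ is not isomorphic to $K_1\vee(K_{n-2-k}+\overline{K_{1+k}})$. In other words, $\mu_f(G)>\frac{n-k}{2}$ unless $G\cong K_1\vee(K_{n-2-k}+\overline{K_{1+k}})$, and the latter graph is a genuine exception. -/

import Mathlib

open scoped BigOperators

noncomputable section

namespace DistSignless

/-- The join `G ∨ H`: the disjoint union of `G` and `H` together with all edges between the two
vertex sets. -/
def join {V W : Type*} (G : SimpleGraph V) (H : SimpleGraph W) : SimpleGraph (V ⊕ W) :=
  (G ⊕g H) ⊔ completeBipartiteGraph V W

/-- The graph `K_1 ∨ (K_a + complement of K_b)`. -/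
def coneGraph (a b : ℕ) : SimpleGraph (Fin 1 ⊕ (Fin a ⊕ Fin b)) :=
  join (⊤ : SimpleGraph (Fin 1)) ((⊤ : SimpleGraph (Fin a)) ⊕g (⊤ : SimpleGraph (Fin b))ᶜ)

variable {V : Type*} [Fintype V]

/-- The distance matrix `D(G)`. -/
def distMatrix (G : SimpleGraph V) : Matrix V V ℝ :=
  Matrix.of fun u v => (G.dist u v : ℝ)

/-- The transmission of a vertex: the sum of its distances to all vertices. -/
def transmission (G : SimpleGraph V) (v : V) : ℝ :=
  ∑ u : V, (G.dist v u : ℝ)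

open Classical in
/-- The distance signless Laplacian matrix `Q(G) = Tr(G) + D(G)`. -/
def distSignlessLaplacian (G : SimpleGraph V) : Matrix V V ℝ :=
  Matrix.diagonal (transmission G) + distMatrix G

open Classical in
/-- The distance signless Laplacian spectral radius `η(G)`: the largest eigenvalue of `Q(G)`. -/
def eta (G : SimpleGraph V) : ℝ :=
  sSup (spectrum ℝ (distSignlessLaplacian G))

open Classical in
/-- On a nonempty vertex set the supremum defining `eta` is a maximum. -/
theorem eta_isGreatest [Nonempty V] (G : SimpleGraph V) :
    IsGreatest (spectrum ℝ (distSignlessLaplacian G)) (eta G) := by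
  have hH : (distSignlessLaplacian G).IsHermitian := by
    refine (Matrix.isHermitian_diagonal_of_self_adjoint _ ?_).add ?_
    · ext v
      simp
    · ext u v
      simp [distMatrix, SimpleGraph.dist_comm]
  have hS := hH.spectrum_real_eq_range_eigenvalues
  have hne : (spectrum ℝ (distSignlessLaplacian G)).Nonempty := by
    rw [hS]; exact Set.range_nonempty _
  have hfin : (spectrum ℝ (distSignlessLaplacian G)).Finite := by
    rw [hS]; exact Set.finite_range _
  exact ⟨hne.csSup_mem hfin, fun x hx => le_csSup hfin.bddAbove hx⟩

open Classical in
/-- A fractional matching of `G`: a function `f : E(G) → [0, 1]` whose sum over the edges incident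
to any given vertex is at most `1`. -/
structure IsFractionalMatching (G : SimpleGraph V) (f : G.edgeSet → ℝ) : Prop where
  mem_Icc : ∀ e, f e ∈ Set.Icc (0 : ℝ) 1
  sum_le_one : ∀ v : V, ∑ e ∈ Finset.univ.filter (fun e : G.edgeSet => v ∈ (e : Sym2 V)), f e ≤ 1

open Classical in
/-- The possible total weights of fractional matchings of `G`. -/
def fractionalMatchingWeights (G : SimpleGraph V) : Set ℝ :=
  {w | ∃ f : G.edgeSet → ℝ, IsFractionalMatching G f ∧ w = ∑ e : G.edgeSet, f e}

/-- The fractional matching number `μ_f(G)`: the maximum total weight of a fractional matching. -/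
def fractionalMatchingNumber (G : SimpleGraph V) : ℝ :=
  sSup (fractionalMatchingWeights G)

/-- The supremum defining `fractionalMatchingNumber` is a maximum. -/
theorem fractionalMatchingNumber_isGreatest (G : SimpleGraph V) :
    IsGreatest (fractionalMatchingWeights G) (fractionalMatchingNumber G) := by
  classical
  have hK : IsCompact {f : G.edgeSet → ℝ | IsFractionalMatching G f} := by
    have hc : IsCompact (Set.univ.pi fun _ : G.edgeSet => Set.Icc (0 : ℝ) 1) :=
      isCompact_univ_pi fun _ => isCompact_Icc
    refine hc.of_isClosed_subset ?_ fun f hf e _ => hf.mem_Icc e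
    have h : {f : G.edgeSet → ℝ | IsFractionalMatching G f} =
        (⋂ e, {f | f e ∈ Set.Icc (0 : ℝ) 1}) ∩
        ⋂ v : V, {f | ∑ e ∈ Finset.univ.filter (fun e : G.edgeSet => v ∈ (e : Sym2 V)), f e ≤ 1} := by
      ext f
      simp only [Set.mem_inter_iff, Set.mem_iInter, Set.mem_ofPred_eq]
      exact ⟨fun hf => ⟨hf.1, fun v => by convert hf.2 v⟩,
        fun hf => ⟨hf.1, fun v => by convert hf.2 v⟩⟩
    rw [h]
    refine (isClosed_iInter fun e => isClosed_Icc.preimage (continuous_apply e)).inter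
      (isClosed_iInter fun v => isClosed_le ?_ continuous_const)
    fun_prop
  have himg : fractionalMatchingWeights G =
      (fun f : G.edgeSet → ℝ => ∑ e, f e) '' {f | IsFractionalMatching G f} := by
    ext w
    constructor
    · rintro ⟨f, hf, rfl⟩
      exact ⟨f, hf, by congr!⟩
    · rintro ⟨f, hf, rfl⟩
      exact ⟨f, hf, by congr!⟩
  have hcomp : IsCompact (fractionalMatchingWeights G) := by
    rw [himg]
    exact hK.image (by fun_prop)
  have hne : (fractionalMatchingWeights G).Nonempty :=
    ⟨_, fun _ => 0, ⟨fun _ => by simp, fun _ => by simp⟩, rfl⟩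
  exact hcomp.isGreatest_sSup hne

end DistSignless

end

/-!
# Distance signless Laplacian spectral radius and fractional matchings

If `μ_f(G) ≤ (n - k) / 2`, Hall's theorem with deficiency, applied to the bipartite double cover of
`G`, produces a nonempty set `S` of `s` vertices and an independent set `I` of `s + k` vertices with
`N(I) ⊆ S` (`exists_independent_of_fractionalMatchingNumber_le`). Two vertices are then at distance
at least `2` when one of them lies in `I` and the other lies outside `S`. This bounds the quadratic
form `∑_{u < v} d(u, v) (x_u + x_v)²` of `Q(G)` from below by an explicit one, `distLower`, whose
value depends only on a few moments of `x` (`sum_sum_distLower_mul_sq`).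

The Perron vector of the extremal graph `K_1 ∨ (K_m + complement of K_t)`, with `m = n - 2 - k` and
`t = k + 1`, takes three values `a`, `b`, `c` on the centre, the clique and the independent vertices.
Its eigenvalue equations show that the spectral radius `η` of the extremal graph satisfies
`η - 2n + 3 ≤ 3n / 5` once `n ≥ 14k + 24` (`perron_estimates`). A suitable test vector for `G` then
does the comparison:

* if `s = 1`, the Perron vector itself has quadratic form at least `η`, with equality only if all
  distances agree with those of the extremal graph, in which case `G` is the extremal graph;
* if `2 ≤ s ≤ n / 4`, let the test vector be `a` at one vertex of `S`, `c` on `t` vertices of `I`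
  and `b` elsewhere. The pairs between the other `s - 1` vertices of `S` and these `t` vertices lose
  one unit of distance each, but the remaining `s - 1` vertices of `I` gain more
  (`small_separator_gain`);
* if `s ≥ n / 4`, the vector equal to `2` on `I` and `1` elsewhere beats the linear bound on `η`
  (`large_separator_gain`).

Hence only the extremal graph has `μ_f(G) ≤ (n - k) / 2` and spectral radius at most `η`. That it
does have `μ_f ≤ (n - k) / 2` is weak duality with the fractional vertex cover of weight `1` on the
centre and `1 / 2` on the clique.
-/

noncomputable section

namespace DistSignless

variable {V : Type*} [Fintype V]

/-! ### The quadratic form of the distance signless Laplacian -/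

theorem distSignlessLaplacian_mulVec (G : SimpleGraph V) (x : V → ℝ) (v : V) :
    (distSignlessLaplacian G).mulVec x v = ∑ u, (G.dist v u : ℝ) * (x v + x u) := by
  classical
  rw [distSignlessLaplacian, Matrix.add_mulVec, Pi.add_apply, Matrix.mulVec_diagonal]
  simp only [transmission, distMatrix, Matrix.mulVec, dotProduct, Matrix.of_apply, mul_add,
    Finset.sum_add_distrib, Finset.sum_mul]

theorem dotProduct_distSignlessLaplacian_mulVec (G : SimpleGraph V) (x : V → ℝ) :
    x ⬝ᵥ (distSignlessLaplacian G).mulVec x =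
      (∑ v, ∑ u, (G.dist v u : ℝ) * (x v + x u) ^ 2) / 2 := by
  have h1 : x ⬝ᵥ (distSignlessLaplacian G).mulVec x =
      ∑ v, ∑ u, (G.dist v u : ℝ) * (x v + x u) * x v := by
    simp only [dotProduct, distSignlessLaplacian_mulVec, Finset.mul_sum]
    exact Finset.sum_congr rfl fun v _ => Finset.sum_congr rfl fun u _ => by ring
  have h2 : x ⬝ᵥ (distSignlessLaplacian G).mulVec x =
      ∑ v, ∑ u, (G.dist v u : ℝ) * (x v + x u) * x u := by
    rw [h1, Finset.sum_comm]
    exact Finset.sum_congr rfl fun v _ => Finset.sum_congr rfl fun u _ => by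
      rw [SimpleGraph.dist_comm]; ring
  have h3 : ∑ v, ∑ u, (G.dist v u : ℝ) * (x v + x u) ^ 2 =
      ∑ v, ∑ u, (G.dist v u : ℝ) * (x v + x u) * x v +
      ∑ v, ∑ u, (G.dist v u : ℝ) * (x v + x u) * x u := by
    simp only [← Finset.sum_add_distrib]
    exact Finset.sum_congr rfl fun v _ => Finset.sum_congr rfl fun u _ => by ring
  rw [h3, ← h1, ← h2]
  ring

theorem distSignlessLaplacian_isHermitian (G : SimpleGraph V) :
    (distSignlessLaplacian G).IsHermitian := by
  classical
  refine Matrix.IsHermitian.add (Matrix.isHermitian_diagonal_of_self_adjoint _ ?_) ?_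
  · ext v
    simp
  · ext u v
    simp [distMatrix, SimpleGraph.dist_comm]

open Classical in
theorem posSemidef_eta_sub [Nonempty V] (G : SimpleGraph V) :
    (algebraMap ℝ (Matrix V V ℝ) (eta G) - distSignlessLaplacian G).PosSemidef := by
  rw [Matrix.posSemidef_iff_isHermitian_and_spectrum_nonneg]
  refine ⟨Matrix.IsHermitian.sub ?_ (distSignlessLaplacian_isHermitian G), ?_⟩
  · rw [Matrix.algebraMap_eq_diagonal]
    refine Matrix.isHermitian_diagonal_of_self_adjoint _ ?_
    ext v
    simp
  · rw [← spectrum.singleton_sub_eq]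
    rintro z ⟨r, rfl, w, hw, rfl⟩
    simpa using (eta_isGreatest G).2 hw

open Classical in
theorem dotProduct_eta_sub_mulVec (G : SimpleGraph V) (x : V → ℝ) :
    x ⬝ᵥ (algebraMap ℝ (Matrix V V ℝ) (eta G) - distSignlessLaplacian G).mulVec x =
      eta G * ∑ v, x v ^ 2 - (∑ v, ∑ u, (G.dist v u : ℝ) * (x v + x u) ^ 2) / 2 := by
  rw [Matrix.sub_mulVec, dotProduct_sub, dotProduct_distSignlessLaplacian_mulVec,
    Matrix.algebraMap_eq_diagonal]
  simp only [dotProduct, Matrix.mulVec_diagonal, Pi.algebraMap_apply, Algebra.algebraMap_self_apply,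
    Finset.mul_sum]
  congr 1
  exact Finset.sum_congr rfl fun v _ => by ring

theorem rayleigh_le_eta [Nonempty V] (G : SimpleGraph V) (x : V → ℝ) :
    (∑ v, ∑ u, (G.dist v u : ℝ) * (x v + x u) ^ 2) / 2 ≤ eta G * ∑ v, x v ^ 2 := by
  classical
  have h := (posSemidef_eta_sub G).dotProduct_mulVec_nonneg x
  rw [star_trivial] at h
  have h2 := dotProduct_eta_sub_mulVec G x
  linarith

/-- The Perron vector: since the off-diagonal entries of `Q(G)` are positive, passing to absolute
values in an eigenvector for `η(G)` can only increase the quadratic form, so it yields another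
eigenvector, and the eigenvalue equation forces it to be positive. -/
theorem exists_pos_eigenvector [Nonempty V] {G : SimpleGraph V} (hG : G.Connected) :
    ∃ y : V → ℝ, (∀ v, 0 < y v) ∧
      ∀ v, ∑ u, (G.dist v u : ℝ) * (y v + y u) = eta G * y v := by
  classical
  have hmem := (eta_isGreatest G).1
  rw [spectrum.mem_iff, Matrix.isUnit_iff_isUnit_det, isUnit_iff_ne_zero, not_not] at hmem
  obtain ⟨x, hx0, hx⟩ := Matrix.exists_mulVec_eq_zero_iff.2 hmem
  have hpsd := posSemidef_eta_sub G
  have hxq := dotProduct_eta_sub_mulVec G x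
  have hyq := dotProduct_eta_sub_mulVec G (fun v => |x v|)
  have hnn := hpsd.dotProduct_mulVec_nonneg (fun v => |x v|)
  rw [star_trivial] at hnn
  have hle : ∑ v, ∑ u, (G.dist v u : ℝ) * (x v + x u) ^ 2 ≤
      ∑ v, ∑ u, (G.dist v u : ℝ) * (|x v| + |x u|) ^ 2 := by
    refine Finset.sum_le_sum fun v _ => Finset.sum_le_sum fun u _ => ?_
    refine mul_le_mul_of_nonneg_left ?_ (Nat.cast_nonneg _)
    rw [← sq_abs (x v + x u)]
    exact pow_le_pow_left₀ (abs_nonneg _) (abs_add_le _ _) 2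
  simp only [sq_abs] at hyq
  have hxz : x ⬝ᵥ (algebraMap ℝ (Matrix V V ℝ) (eta G) - distSignlessLaplacian G).mulVec x = 0 := by
    refine Eq.trans (congrArg (x ⬝ᵥ ·) ?_) (dotProduct_zero x)
    convert hx
  have hzero : (fun v => |x v|) ⬝ᵥ (algebraMap ℝ (Matrix V V ℝ) (eta G) -
      distSignlessLaplacian G).mulVec (fun v => |x v|) = 0 := by
    linarith
  have hker := (hpsd.dotProduct_mulVec_zero_iff (fun v => |x v|)).1 (by rwa [star_trivial])
  have heig : ∀ v, ∑ u, (G.dist v u : ℝ) * (|x v| + |x u|) = eta G * |x v| := by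
    intro v
    have := congrFun hker v
    rw [Matrix.sub_mulVec, Pi.sub_apply, distSignlessLaplacian_mulVec,
      Matrix.algebraMap_eq_diagonal, Matrix.mulVec_diagonal] at this
    simp only [Pi.algebraMap_apply, Algebra.algebraMap_self_apply, Pi.zero_apply] at this
    linarith
  refine ⟨fun v => |x v|, fun v => ?_, heig⟩
  refine lt_of_le_of_ne (abs_nonneg _) fun hv => hx0 ?_
  have hv' : |x v| = 0 := hv.symm
  have hs := heig v
  rw [hv', mul_zero, Finset.sum_eq_zero_iff_of_nonneg (fun u _ => by positivity)] at hs
  funext u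
  by_cases huv : v = u
  · subst huv
    exact abs_eq_zero.1 hv'
  · have h1 := hs u (Finset.mem_univ u)
    have hd : (G.dist v u : ℝ) ≠ 0 := by exact_mod_cast (hG.pos_dist_of_ne huv).ne'
    rw [zero_add] at h1
    exact abs_eq_zero.1 ((mul_eq_zero.1 h1).resolve_left hd)

/-! ### Fractional matchings -/

/-- Weak linear programming duality: a fractional vertex cover bounds the fractional matching
number from above. -/
theorem fractionalMatchingNumber_le_of_cover (G : SimpleGraph V) (w : V → ℝ) (hw : ∀ v, 0 ≤ w v)
    (hcov : ∀ u v, G.Adj u v → 1 ≤ w u + w v) : fractionalMatchingNumber G ≤ ∑ v, w v := by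
  classical
  obtain ⟨f, hf, hfw⟩ := (fractionalMatchingNumber_isGreatest G).1
  rw [hfw]
  have key : ∀ e : G.edgeSet, f e ≤ ∑ v, if v ∈ (e : Sym2 V) then w v * f e else 0 := by
    rintro ⟨e, he⟩
    induction e with
    | _ a b =>
      have hab : G.Adj a b := he
      have hsub : ∑ v ∈ ({a, b} : Finset V), w v * f ⟨s(a, b), he⟩ =
          ∑ v, if v ∈ s(a, b) then w v * f ⟨s(a, b), he⟩ else 0 := by
        rw [← Finset.sum_filter]
        refine Finset.sum_congr ?_ fun _ _ => rfl
        ext v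
        simp
      rw [← hsub, Finset.sum_pair hab.ne, ← add_mul]
      exact le_mul_of_one_le_left (hf.mem_Icc _).1 (hcov a b hab)
  calc ∑ e, f e ≤ ∑ e : G.edgeSet, ∑ v, if v ∈ (e : Sym2 V) then w v * f e else 0 := by
        convert Finset.sum_le_sum fun e (_ : e ∈ (Finset.univ : Finset G.edgeSet)) => key e
    _ = ∑ v, w v * ∑ e ∈ Finset.univ.filter (fun e : G.edgeSet => v ∈ (e : Sym2 V)), f e := by
        rw [Finset.sum_comm]
        refine Finset.sum_congr rfl fun v _ => ?_
        rw [Finset.mul_sum, Finset.sum_filter]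
    _ ≤ ∑ v, w v := by
        refine Finset.sum_le_sum fun v _ => ?_
        refine mul_le_of_le_one_right (hw v) ?_
        convert hf.sum_le_one v

/-- A partial injection along edges, that is, a matching of the bipartite double cover, gives a
fractional matching of half its size. -/
theorem card_div_two_le_fractionalMatchingNumber (G : SimpleGraph V) (U : Finset V) (g : V → V)
    (hadj : ∀ u ∈ U, G.Adj u (g u)) (hinj : Set.InjOn g U) :
    (U.card : ℝ) / 2 ≤ fractionalMatchingNumber G := by
  classical
  set f : G.edgeSet → ℝ := fun e => ∑ u ∈ U, if (e : Sym2 V) = s(u, g u) then (1 / 2 : ℝ) else 0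
    with hf
  have hnn : ∀ e, 0 ≤ f e := fun e => Finset.sum_nonneg fun u _ => by split_ifs <;> norm_num
  have hsum : ∀ v : V,
      ∑ e ∈ Finset.univ.filter (fun e : G.edgeSet => v ∈ (e : Sym2 V)), f e ≤ 1 := by
    intro v
    simp only [hf]
    rw [Finset.sum_comm]
    have h1 : ∀ u ∈ U, (∑ e ∈ Finset.univ.filter (fun e : G.edgeSet => v ∈ (e : Sym2 V)),
        if (e : Sym2 V) = s(u, g u) then (1 / 2 : ℝ) else 0) ≤
        (if u = v then 1 / 2 else 0) + (if g u = v then 1 / 2 else 0) := by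
      intro u hu
      by_cases hv : v ∈ s(u, g u)
      · have he : ∀ e : G.edgeSet, ((e : Sym2 V) = s(u, g u)) ↔ e = ⟨s(u, g u), hadj u hu⟩ :=
          fun e => by rw [Subtype.ext_iff]
        simp only [he]
        rw [Finset.sum_ite_eq']
        have : (1 / 2 : ℝ) ≤ (if u = v then 1 / 2 else 0) + (if g u = v then 1 / 2 else 0) := by
          rcases Sym2.mem_iff.1 hv with h | h
          · rw [if_pos h.symm]
            split_ifs <;> norm_num
          · rw [if_pos h.symm]
            split_ifs <;> norm_num
        split_ifs at this ⊢ <;> linarith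
      · rw [Finset.sum_eq_zero]
        · split_ifs <;> norm_num
        · intro e he
          rw [if_neg]
          rintro h
          rw [Finset.mem_filter, h] at he
          exact hv he.2
    refine (Finset.sum_le_sum h1).trans ?_
    rw [Finset.sum_add_distrib, ← Finset.sum_filter, ← Finset.sum_filter, Finset.sum_const,
      Finset.sum_const]
    have c1 : (U.filter fun u => u = v).card ≤ 1 :=
      Finset.card_le_one.2 fun a ha b hb => by
        rw [(Finset.mem_filter.1 ha).2, (Finset.mem_filter.1 hb).2]
    have c2 : (U.filter fun u => g u = v).card ≤ 1 :=
      Finset.card_le_one.2 fun a ha b hb => by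
        rw [Finset.mem_filter] at ha hb
        exact hinj ha.1 hb.1 (ha.2.trans hb.2.symm)
    have c1' : ((U.filter fun u => u = v).card : ℝ) ≤ 1 := by exact_mod_cast c1
    have c2' : ((U.filter fun u => g u = v).card : ℝ) ≤ 1 := by exact_mod_cast c2
    simp only [nsmul_eq_mul]
    linarith
  have hfm : IsFractionalMatching G f := by
    refine ⟨fun e => ⟨hnn e, ?_⟩, fun v => ?_⟩
    · have hmem : e ∈ Finset.univ.filter
          (fun e' : G.edgeSet => (e : Sym2 V).out.1 ∈ (e' : Sym2 V)) := by
        rw [Finset.mem_filter]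
        exact ⟨Finset.mem_univ _, Sym2.out_fst_mem _⟩
      exact (Finset.single_le_sum (fun e' _ => hnn e') hmem).trans (hsum _)
    · convert hsum v
  refine (fractionalMatchingNumber_isGreatest G).2 ⟨f, hfm, ?_⟩
  have htot : ∑ e : G.edgeSet, f e = (U.card : ℝ) / 2 := by
    simp only [hf]
    rw [Finset.sum_comm]
    have h1 : ∀ u ∈ U, (∑ e : G.edgeSet,
        if (e : Sym2 V) = s(u, g u) then (1 / 2 : ℝ) else 0) = 1 / 2 := by
      intro u hu
      have he : ∀ e : G.edgeSet, ((e : Sym2 V) = s(u, g u)) ↔ e = ⟨s(u, g u), hadj u hu⟩ :=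
        fun e => by rw [Subtype.ext_iff]
      simp only [he]
      rw [Finset.sum_ite_eq' Finset.univ _ (fun _ => (1 / 2 : ℝ)), if_pos (Finset.mem_univ _)]
    rw [Finset.sum_congr rfl h1, Finset.sum_const, nsmul_eq_mul]
    ring
  rw [← htot]

/-- Hall's theorem with deficiency: if no set of vertices has at least `d + 1` fewer neighbours
than elements, then all but at most `d` vertices can be sent injectively to neighbours. -/
theorem exists_injOn_adj_of_deficiency (G : SimpleGraph V) [DecidableRel G.Adj] [DecidableEq V]
    (d : ℕ) (h : ∀ A : Finset V, A.card ≤ (A.biUnion fun v => G.neighborFinset v).card + d) :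
    ∃ (U : Finset V) (g : V → V), (∀ u ∈ U, G.Adj u (g u)) ∧ Set.InjOn g U ∧
      Fintype.card V ≤ U.card + d := by
  -- `d` dummy neighbours are added to every vertex
  obtain ⟨f, hf, hft⟩ := (Finset.all_card_le_biUnion_card_iff_exists_injective
    (fun v : V => (G.neighborFinset v).disjSum (Finset.univ : Finset (Fin d)))).1 fun A => by
      rcases A.eq_empty_or_nonempty with rfl | ⟨a, ha⟩
      · simp
      · refine (h A).trans ?_
        have hsub : (A.biUnion fun v => G.neighborFinset v).disjSum (Finset.univ : Finset (Fin d)) ⊆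
            A.biUnion fun v => (G.neighborFinset v).disjSum (Finset.univ : Finset (Fin d)) := by
          intro z hz
          rw [Finset.mem_biUnion]
          rcases z with z | z
          · rw [Finset.inl_mem_disjSum, Finset.mem_biUnion] at hz
            obtain ⟨v, hv, hvz⟩ := hz
            exact ⟨v, hv, Finset.inl_mem_disjSum.2 hvz⟩
          · exact ⟨a, ha, Finset.inr_mem_disjSum.2 (Finset.mem_univ _)⟩
        refine le_trans ?_ (Finset.card_le_card hsub)
        rw [Finset.card_disjSum, Finset.card_univ, Fintype.card_fin]
  refine ⟨Finset.univ.filter fun u => (f u).isLeft, fun u => (f u).elim id fun _ => u, ?_, ?_, ?_⟩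
  · intro u hu
    rw [Finset.mem_filter] at hu
    have := hft u
    rcases hfu : f u with z | z
    · rw [hfu, Finset.inl_mem_disjSum, SimpleGraph.mem_neighborFinset] at this
      simpa [hfu] using this
    · simp [hfu] at hu
  · intro u hu v hv huv
    simp only [Finset.coe_filter, Finset.mem_univ, true_and, Set.mem_ofPred_eq] at hu hv
    rcases hfu : f u with z | z
    · rcases hfv : f v with z' | z'
      · simp only [hfu, hfv, Sum.elim_inl, id] at huv
        exact hf (by rw [hfu, hfv, huv])
      · simp [hfv] at hv
    · simp [hfu] at hu
  · have hsplit := Finset.card_filter_add_card_filter_not (s := (Finset.univ : Finset V))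
      (fun u => (f u).isLeft = true)
    have hle : (Finset.univ.filter fun u => ¬ (f u).isLeft = true).card ≤ d := by
      have : ((Finset.univ.filter fun u => ¬ (f u).isLeft = true).image f) ⊆
          (Finset.univ : Finset (Fin d)).map ⟨Sum.inr, Sum.inr_injective⟩ := by
        intro z hz
        rw [Finset.mem_image] at hz
        obtain ⟨u, hu, rfl⟩ := hz
        rcases hfu : f u with z | z
        · simp [hfu] at hu
        · simp
      have h2 := Finset.card_le_card this
      rw [Finset.card_image_of_injective _ hf, Finset.card_map, Finset.card_univ,
        Fintype.card_fin] at h2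
      exact h2
    rw [Finset.card_univ] at hsplit
    omega

/-- The half of the fractional Tutte–Berge formula that is needed: a small fractional matching
number is witnessed by an independent set `I` all of whose neighbours lie in a set `S` with `k`
fewer elements. -/
theorem exists_independent_of_fractionalMatchingNumber_le (G : SimpleGraph V) (hG : G.Connected)
    (k : ℕ) (hk : 1 ≤ k) (hcard : 2 ≤ Fintype.card V)
    (h : fractionalMatchingNumber G ≤ ((Fintype.card V : ℝ) - k) / 2) :
    ∃ S I : Finset V, 1 ≤ S.card ∧ I.card = S.card + k ∧ Disjoint S I ∧
      ∀ u ∈ I, ∀ v, G.Adj u v → v ∈ S := by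
  classical
  have hA : ∃ A : Finset V, (A.biUnion fun v => G.neighborFinset v).card + k ≤ A.card := by
    by_contra! hcon
    obtain ⟨U, g, hadj, hinj, hU⟩ := exists_injOn_adj_of_deficiency G (k - 1) fun A => by
      have := hcon A
      omega
    have h1 := card_div_two_le_fractionalMatchingNumber G U g hadj hinj
    have h2 : (Fintype.card V : ℝ) + 1 ≤ U.card + k := by
      have : Fintype.card V + 1 ≤ U.card + k := by omega
      exact_mod_cast this
    linarith
  obtain ⟨A, hA⟩ := hA
  set N := A.biUnion fun v => G.neighborFinset v with hN
  have hmemN : ∀ u ∈ A, ∀ v, G.Adj u v → v ∈ N := fun u hu v huv =>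
    Finset.mem_biUnion.2 ⟨u, hu, (G.mem_neighborFinset u v).2 huv⟩
  have hI : ∀ u ∈ A \ N, ∀ v, G.Adj u v → v ∈ N \ A := by
    intro u hu v huv
    rw [Finset.mem_sdiff] at hu ⊢
    exact ⟨hmemN u hu.1 v huv, fun hv => hu.2 (hmemN v hv u huv.symm)⟩
  have hc : (N \ A).card + k ≤ (A \ N).card := by
    have h1 := Finset.card_sdiff_add_card_inter N A
    have h2 := Finset.card_sdiff_add_card_inter A N
    rw [Finset.inter_comm] at h2
    omega
  obtain ⟨I, hIsub, hIcard⟩ := Finset.exists_subset_card_eq hc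
  refine ⟨N \ A, I, ?_, hIcard, ?_, fun u hu => hI u (hIsub hu)⟩
  · have hne : I.Nonempty := Finset.card_pos.1 (by omega)
    obtain ⟨u, hu⟩ := hne
    have : Nontrivial V := Fintype.one_lt_card_iff_nontrivial.1 hcard
    obtain ⟨v, hv⟩ := hG.preconnected.exists_adj_of_nontrivial u
    exact Finset.card_pos.2 ⟨v, hI u (hIsub hu) v hv⟩
  · rw [Finset.disjoint_left]
    intro x hx hx'
    have := Finset.mem_sdiff.1 (hIsub hx')
    exact (Finset.mem_sdiff.1 hx).2 this.1

/-! ### Distances forced by an independent set -/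

open Classical in
/-- For a set `I` of vertices whose neighbours all lie in `S`, a lower bound for the distance of two
distinct vertices: it is `2` if one of them is in `I` and the other is not in `S`, and `1`
otherwise. -/
def distLower (S I : Finset V) (u v : V) : ℝ :=
  if u = v then 0 else if (u ∈ I ∧ v ∉ S) ∨ (v ∈ I ∧ u ∉ S) then 2 else 1

theorem distLower_le_dist {V : Type*} {G : SimpleGraph V} (hG : G.Connected) {S I : Finset V}
    (hN : ∀ u ∈ I, ∀ v, G.Adj u v → v ∈ S) (u v : V) :
    distLower S I u v ≤ G.dist u v := by
  unfold distLower
  split_ifs with h1 h2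
  · positivity
  · have hna : ¬ G.Adj u v := by
      rintro hadj
      rcases h2 with ⟨hu, hv⟩ | ⟨hv, hu⟩
      · exact hv (hN u hu v hadj)
      · exact hu (hN v hv u hadj.symm)
    exact_mod_cast hG.one_lt_dist_of_ne_of_not_adj h1 hna
  · exact_mod_cast hG.pos_dist_of_ne h1

theorem sum_sum_mul_mul_add_sq (f g x : V → ℝ) :
    ∑ u, ∑ v, f u * g v * (x u + x v) ^ 2 =
      (∑ u, f u * x u ^ 2) * (∑ v, g v) + 2 * (∑ u, f u * x u) * (∑ v, g v * x v) +
        (∑ u, f u) * (∑ v, g v * x v ^ 2) := by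
  rw [mul_assoc 2]
  simp only [Finset.sum_mul_sum]
  simp only [Finset.mul_sum, ← Finset.sum_add_distrib]
  exact Finset.sum_congr rfl fun u _ => Finset.sum_congr rfl fun v _ => by ring

/-- The quadratic form of the matrix `distLower S I` in terms of the moments of the vector over
the whole vertex set, over `S` and over `I`. -/
theorem sum_sum_distLower_mul_sq {S I : Finset V} (hSI : Disjoint S I) (x : V → ℝ) :
    (∑ u, ∑ v, distLower S I u v * (x u + x v) ^ 2) / 2 =
      Fintype.card V * (∑ u, x u ^ 2) + (∑ u, x u) ^ 2 +
      (∑ u ∈ I, x u ^ 2) * (Fintype.card V - S.card) +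
      2 * (∑ u ∈ I, x u) * ((∑ u, x u) - ∑ u ∈ S, x u) +
      I.card * ((∑ u, x u ^ 2) - ∑ u ∈ S, x u ^ 2) -
      (∑ u ∈ I, x u ^ 2) * I.card - (∑ u ∈ I, x u) ^ 2 -
      2 * (∑ u, x u ^ 2) - 2 * (∑ u ∈ I, x u ^ 2) := by
  classical
  set i : V → ℝ := fun u => if u ∈ I then 1 else 0 with hi
  set s : V → ℝ := fun u => if u ∈ S then 1 else 0 with hs
  -- inclusion-exclusion off the diagonal; the diagonal is subtracted afterwards
  have hterm : ∀ u v, distLower S I u v * (x u + x v) ^ 2 =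
      1 * 1 * (x u + x v) ^ 2 + i u * (1 - s v) * (x u + x v) ^ 2 +
      (1 - s u) * i v * (x u + x v) ^ 2 - i u * i v * (x u + x v) ^ 2 -
      (if u = v then (1 + i u) * (4 * x u ^ 2) else 0) := by
    intro u v
    have hd := Finset.disjoint_left.1 hSI
    unfold distLower
    simp only [hi, hs]
    by_cases huv : u = v
    · subst huv
      by_cases h1 : u ∈ I <;> by_cases h2 : u ∈ S <;> simp [h1, h2]
      · exact absurd h1 (hd h2)
      all_goals ring
    · by_cases h1 : u ∈ I <;> by_cases h2 : u ∈ S <;> by_cases h3 : v ∈ I <;>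
        by_cases h4 : v ∈ S <;> simp [h1, h2, h3, h4, huv]
      all_goals first
        | exact absurd h1 (hd h2)
        | exact absurd h3 (hd h4)
        | ring
  have hI0 : ∑ u, i u = I.card := by simp [hi]
  have hI1 : ∑ u, i u * x u = ∑ u ∈ I, x u := by simp [hi]
  have hI2 : ∑ u, i u * x u ^ 2 = ∑ u ∈ I, x u ^ 2 := by simp [hi]
  have hS0 : ∑ u, s u = S.card := by simp [hs]
  have hS1 : ∑ u, s u * x u = ∑ u ∈ S, x u := by simp [hs]
  have hS2 : ∑ u, s u * x u ^ 2 = ∑ u ∈ S, x u ^ 2 := by simp [hs]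
  have hC0 : ∑ u, (1 - s u) = Fintype.card V - S.card := by
    rw [Finset.sum_sub_distrib, hS0]; simp
  have hC1 : ∑ u, (1 - s u) * x u = (∑ u, x u) - ∑ u ∈ S, x u := by
    simp only [sub_mul, one_mul]
    rw [Finset.sum_sub_distrib, hS1]
  have hC2 : ∑ u, (1 - s u) * x u ^ 2 = (∑ u, x u ^ 2) - ∑ u ∈ S, x u ^ 2 := by
    simp only [sub_mul, one_mul]
    rw [Finset.sum_sub_distrib, hS2]
  have hdiag : ∑ u, (1 + i u) * (4 * x u ^ 2) =
      4 * (∑ u, x u ^ 2) + 4 * ∑ u ∈ I, x u ^ 2 := by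
    rw [← hI2, Finset.mul_sum, Finset.mul_sum, ← Finset.sum_add_distrib]
    exact Finset.sum_congr rfl fun u _ => by ring
  have hone := sum_sum_mul_mul_add_sq (fun _ : V => (1 : ℝ)) (fun _ => 1) x
  have hIC := sum_sum_mul_mul_add_sq i (fun v => 1 - s v) x
  have hCI := sum_sum_mul_mul_add_sq (fun v => 1 - s v) i x
  have hII := sum_sum_mul_mul_add_sq i i x
  simp only [one_mul] at hone
  simp only [hterm, Finset.sum_sub_distrib, Finset.sum_add_distrib, one_mul, hIC, hCI, hII, hone,
    Finset.sum_ite_eq, Finset.mem_univ, if_true, hI0, hI1, hI2, hC0, hC1, hC2, hdiag]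
  simp only [Finset.sum_const, Finset.card_univ, nsmul_eq_mul, mul_one]
  ring

open Classical in
/-- The vector with value `a` at `p`, `c` on `J` and `b` elsewhere. -/
def threeValued (p : V) (J : Finset V) (a b c : ℝ) (v : V) : ℝ :=
  if v = p then a else if v ∈ J then c else b

open Classical in
theorem sum_threeValued {V : Type*} {p : V} {J : Finset V} (hp : p ∉ J) (a b c : ℝ) (φ : ℝ → ℝ)
    (F : Finset V) :
    ∑ v ∈ F, φ (threeValued p J a b c v) =
      F.card * φ b + (if p ∈ F then φ a - φ b else 0) + (F ∩ J).card * (φ c - φ b) := by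
  have h : ∀ v, φ (threeValued p J a b c v) =
      φ b + (if v = p then φ a - φ b else 0) + (if v ∈ J then φ c - φ b else 0) := by
    intro v
    unfold threeValued
    by_cases h1 : v = p
    · subst h1
      simp [hp]
    · by_cases h2 : v ∈ J <;> simp [h1, h2]
  simp only [h, Finset.sum_add_distrib, Finset.sum_const, nsmul_eq_mul, Finset.sum_ite_eq']
  rw [← Finset.sum_filter, Finset.sum_const, nsmul_eq_mul, Finset.filter_mem_eq_inter]

/-- The quadratic form of `distLower S I` at a three-valued vector. -/
theorem sum_sum_distLower_threeValued {S I J : Finset V} (hSI : Disjoint S I) {p : V} (hp : p ∈ S)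
    (hJ : J ⊆ I) (a b c n s i t : ℝ) (hn : (Fintype.card V : ℝ) = n) (hs : (S.card : ℝ) = s)
    (hi : (I.card : ℝ) = i) (ht : (J.card : ℝ) = t) :
    (∑ v, threeValued p J a b c v ^ 2 = a ^ 2 + (n - 1 - t) * b ^ 2 + t * c ^ 2) ∧
    (∑ u, ∑ v, distLower S I u v *
        (threeValued p J a b c u + threeValued p J a b c v) ^ 2) / 2 =
      (n - 2 + i) * (a ^ 2 + (n - 1 - t) * b ^ 2 + t * c ^ 2) + (a + (n - 1 - t) * b + t * c) ^ 2 +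
      (t * c ^ 2 + (i - t) * b ^ 2) * (n - s - i - 2) +
      2 * (t * c + (i - t) * b) * ((n - s - t) * b + t * c) -
      i * (a ^ 2 + (s - 1) * b ^ 2) - (t * c + (i - t) * b) ^ 2 := by
  classical
  have hd := Finset.disjoint_left.1 hSI
  have hpI : p ∉ I := hd hp
  have hpJ : p ∉ J := fun h => hpI (hJ h)
  have hSJ : S ∩ J = ∅ := Finset.disjoint_iff_inter_eq_empty.1 (hSI.mono_right hJ)
  have hIJ : I ∩ J = J := Finset.inter_eq_right.2 hJ
  have hU1 := sum_threeValued hpJ a b c id Finset.univ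
  have hU2 := sum_threeValued hpJ a b c (· ^ 2) Finset.univ
  have hS1 := sum_threeValued hpJ a b c id S
  have hS2 := sum_threeValued hpJ a b c (· ^ 2) S
  have hI1 := sum_threeValued hpJ a b c id I
  have hI2 := sum_threeValued hpJ a b c (· ^ 2) I
  simp only [id, Finset.mem_univ, if_true, Finset.univ_inter, Finset.card_univ, hSJ, hIJ, hp, hpI,
    if_false, Finset.card_empty, hn, hs, hi, ht, Nat.cast_zero] at hU1 hU2 hS1 hS2 hI1 hI2
  refine ⟨by rw [hU2]; ring, ?_⟩
  rw [sum_sum_distLower_mul_sq hSI, hU1, hU2, hS1, hS2, hI1, hI2, hn, hs, hi]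
  ring

/-! ### The Perron vector of the extremal graph -/

theorem coneGraph_adj {m t : ℕ} (u v : Fin 1 ⊕ (Fin m ⊕ Fin t)) :
    (coneGraph m t).Adj u v ↔
      u ≠ v ∧ (u = Sum.inl 0 ∨ v = Sum.inl 0 ∨
        ∃ i j, u = Sum.inr (Sum.inl i) ∧ v = Sum.inr (Sum.inl j)) := by
  rcases u with u | u | u <;> rcases v with v | v | v <;>
    simp [coneGraph, join, Fin.fin_one_eq_zero]

theorem coneGraph_connected (m t : ℕ) : (coneGraph m t).Connected := by
  rw [SimpleGraph.connected_iff_exists_forall_reachable]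
  refine ⟨Sum.inl 0, fun v => ?_⟩
  by_cases h : Sum.inl 0 = v
  · rw [h]
  · exact SimpleGraph.Adj.reachable ((coneGraph_adj _ _).2 ⟨h, Or.inl rfl⟩)

open Classical in
theorem coneGraph_dist {m t : ℕ} (u v : Fin 1 ⊕ (Fin m ⊕ Fin t)) :
    (coneGraph m t).dist u v = if u = v then 0 else if (coneGraph m t).Adj u v then 1 else 2 := by
  split_ifs with h1 h2
  · rw [h1, SimpleGraph.dist_self]
  · exact SimpleGraph.dist_eq_one_iff_adj.2 h2
  · have hlt := (coneGraph_connected m t).one_lt_dist_of_ne_of_not_adj h1 h2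
    have hu : Sum.inl 0 ≠ u := by
      rintro rfl
      exact h2 ((coneGraph_adj _ _).2 ⟨h1, Or.inl rfl⟩)
    have hv : Sum.inl 0 ≠ v := by
      rintro rfl
      exact h2 ((coneGraph_adj _ _).2 ⟨h1, Or.inr (Or.inl rfl)⟩)
    have h3 : (coneGraph m t).dist u v ≤
        (coneGraph m t).dist u (Sum.inl 0) + (coneGraph m t).dist (Sum.inl 0) v :=
      (coneGraph_connected m t).dist_triangle
    rw [SimpleGraph.dist_comm (u := u) (v := Sum.inl 0), SimpleGraph.dist_eq_one_iff_adj.2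
      ((coneGraph_adj _ _).2 ⟨hu, Or.inl rfl⟩), SimpleGraph.dist_eq_one_iff_adj.2
      ((coneGraph_adj _ _).2 ⟨hv, Or.inl rfl⟩)] at h3
    omega

/-- The Perron vector of the extremal graph is constant on the three classes of vertices: the
eigenvalue equation expresses each entry through sums over whole classes. -/
theorem exists_coneGraph_perron (m t : ℕ) (hm : 1 ≤ m) (ht : 1 ≤ t) :
    ∃ a b c : ℝ, 0 < a ∧ 0 < b ∧ 0 < c ∧
      eta (coneGraph m t) * a = (m + t) * a + m * b + t * c ∧
      eta (coneGraph m t) * b = (2 * m + 2 * t - 1) * b + a + 2 * t * c ∧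
      eta (coneGraph m t) * c = (2 * m + 4 * t - 3) * c + a + 2 * m * b := by
  classical
  obtain ⟨y, hpos, hy⟩ := exists_pos_eigenvector (coneGraph_connected m t)
  set η := eta (coneGraph m t)
  set a := y (Sum.inl 0) with ha
  have hdl : ∀ (k : ℕ) (z : Fin k → ℝ) (i : Fin k) (w : ℝ),
      ∑ j, (if i = j then 0 else w * (z i + z j)) = w * ((k - 2) * z i + ∑ j, z j) := by
    intro k z i w
    have : ∀ j, (if i = j then 0 else w * (z i + z j)) =
        w * z i + w * z j - (if i = j then 2 * w * z i else 0) := by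
      intro j
      split_ifs with h
      · rw [h]; ring
      · ring
    simp only [this, Finset.sum_sub_distrib, Finset.sum_add_distrib, Finset.sum_const,
      Finset.sum_ite_eq, Finset.mem_univ, if_true, Finset.card_univ, Fintype.card_fin,
      nsmul_eq_mul, ← Finset.mul_sum]
    ring
  have hsum : ∀ (k : ℕ) (z : Fin k → ℝ) (w q : ℝ),
      ∑ j, w * (q + z j) = w * (k * q + ∑ j, z j) := by
    intro k z w q
    rw [← Finset.mul_sum, Finset.sum_add_distrib]
    simp
  have hnest : ∀ (k : ℕ) (i j : Fin k) (p q : ℝ),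
      (if i = j then 0 else if i = j then p else q) = if i = j then 0 else q := by
    intro k i j p q
    split_ifs <;> rfl
  set B := ∑ j, y (Sum.inr (Sum.inl j)) with hB
  set C := ∑ j, y (Sum.inr (Sum.inr j)) with hC
  have e1 : (m + t) * a + B + C = η * a := by
    have h := hy (Sum.inl 0)
    simp only [Fintype.sum_sum_type, coneGraph_dist, coneGraph_adj] at h
    simp at h
    have h1 := hsum m (fun j => y (Sum.inr (Sum.inl j))) 1 a
    have h2 := hsum t (fun j => y (Sum.inr (Sum.inr j))) 1 a
    simp only [one_mul] at h1 h2
    rw [← h, h1, h2]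
    ring
  have e2 : ∀ i, (y (Sum.inr (Sum.inl i)) + a) + ((m - 2) * y (Sum.inr (Sum.inl i)) + B) +
      2 * (t * y (Sum.inr (Sum.inl i)) + C) = η * y (Sum.inr (Sum.inl i)) := by
    intro i
    have h := hy (Sum.inr (Sum.inl i))
    simp only [Fintype.sum_sum_type, coneGraph_dist, coneGraph_adj] at h
    simp [hnest] at h
    have h1 := hdl m (fun j => y (Sum.inr (Sum.inl j))) i 1
    have h2 := hsum t (fun j => y (Sum.inr (Sum.inr j))) 2 (y (Sum.inr (Sum.inl i)))
    simp only [one_mul] at h1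
    rw [← h, h1, h2]
    ring
  have e3 : ∀ i, (y (Sum.inr (Sum.inr i)) + a) + 2 * (m * y (Sum.inr (Sum.inr i)) + B) +
      2 * ((t - 2) * y (Sum.inr (Sum.inr i)) + C) = η * y (Sum.inr (Sum.inr i)) := by
    intro i
    have h := hy (Sum.inr (Sum.inr i))
    simp only [Fintype.sum_sum_type, coneGraph_dist, coneGraph_adj] at h
    simp at h
    have h1 := hdl t (fun j => y (Sum.inr (Sum.inr j))) i 2
    have h2 := hsum m (fun j => y (Sum.inr (Sum.inl j))) 2 (y (Sum.inr (Sum.inr i)))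
    rw [← h, h1, h2]
    ring
  have hBnn : 0 ≤ B := Finset.sum_nonneg fun j _ => (hpos _).le
  have hCnn : 0 ≤ C := Finset.sum_nonneg fun j _ => (hpos _).le
  have hapos : 0 < a := hpos _
  set i₀ : Fin m := ⟨0, hm⟩
  set j₀ : Fin t := ⟨0, ht⟩
  have hbconst : ∀ i, y (Sum.inr (Sum.inl i)) = y (Sum.inr (Sum.inl i₀)) := by
    intro i
    have h1 := e2 i
    have h2 := e2 i₀
    have hne : η - m + 1 - 2 * t ≠ 0 := by
      intro h0
      have : (η - m + 1 - 2 * t) * y (Sum.inr (Sum.inl i)) = a + B + 2 * C := by linarith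
      rw [h0, zero_mul] at this
      linarith
    refine mul_left_cancel₀ hne ?_
    linarith
  have hcconst : ∀ i, y (Sum.inr (Sum.inr i)) = y (Sum.inr (Sum.inr j₀)) := by
    intro i
    have h1 := e3 i
    have h2 := e3 j₀
    have hne : η - 2 * m + 3 - 2 * t ≠ 0 := by
      intro h0
      have : (η - 2 * m + 3 - 2 * t) * y (Sum.inr (Sum.inr i)) = a + 2 * B + 2 * C := by linarith
      rw [h0, zero_mul] at this
      linarith
    refine mul_left_cancel₀ hne ?_
    linarith
  have hB' : B = m * y (Sum.inr (Sum.inl i₀)) := by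
    rw [hB, Finset.sum_congr rfl fun i _ => hbconst i]
    simp
  have hC' : C = t * y (Sum.inr (Sum.inr j₀)) := by
    rw [hC, Finset.sum_congr rfl fun i _ => hcconst i]
    simp
  refine ⟨a, y (Sum.inr (Sum.inl i₀)), y (Sum.inr (Sum.inr j₀)), hapos, hpos _, hpos _, ?_, ?_, ?_⟩
  · rw [← e1, hB', hC']
  · rw [← e2 i₀, hB', hC']
    ring
  · rw [← e3 j₀, hB', hC']
    ring

/-! ### Numerical estimates -/

/-- Consequences of the eigenvalue equations of the extremal graph, in terms of the shifted
eigenvalue `θ = η - 2n + 3`. -/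
theorem perron_estimates {n t a b c θ : ℝ} (ht : 2 ≤ t) (hn : 14 * t + 10 ≤ n) (ha : 0 < a)
    (hb : 0 < b) (hc : 0 < c) (e1 : (θ + n - 2) * a = (n - 1 - t) * b + t * c)
    (e2 : θ * b = a + 2 * t * c) (e3 : (θ - 2 * t + 2) * c = a + 2 * (n - 1 - t) * b) :
    2 * t * c ≤ θ * b ∧ θ ≤ 3 / 5 * n ∧
      θ ^ 2 - (2 * t - 1) * θ + (2 * t - 2) ≤ 2 * t * (2 * n - 2 * t - 1) := by
  have hθ : 0 < θ := by
    have : 0 < θ * b := by rw [e2]; positivity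
    exact pos_of_mul_pos_left this hb.le
  have hab : a ≤ b := by
    have h1 : 0 ≤ (θ + n - 2) * (b - a) := by
      have : 0 < t * c := by positivity
      have : 0 < t * b := by positivity
      nlinarith
    have h2 : 0 < θ + n - 2 := by linarith
    have := nonneg_of_mul_nonneg_right h1 h2
    linarith
  have hθ' : 0 < θ - 2 * t + 2 := by
    have : 0 < (θ - 2 * t + 2) * c := by
      rw [e3]
      have : 0 < (n - 1 - t) * b := mul_pos (by linarith) hb
      linarith
    exact pos_of_mul_pos_left this hc.le
  have hquad : θ ^ 2 - (2 * t - 1) * θ + (2 * t - 2) ≤ 2 * t * (2 * n - 2 * t - 1) := by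
    have h1 : (θ - 1) * b ≤ 2 * t * c := by linarith
    have h2 : (θ - 2 * t + 2) * c ≤ (2 * n - 2 * t - 1) * b := by linarith
    have h3 : (θ - 2 * t + 2) * ((θ - 1) * b) ≤ 2 * t * ((2 * n - 2 * t - 1) * b) :=
      calc (θ - 2 * t + 2) * ((θ - 1) * b) ≤ (θ - 2 * t + 2) * (2 * t * c) :=
            mul_le_mul_of_nonneg_left h1 hθ'.le
        _ = 2 * t * ((θ - 2 * t + 2) * c) := by ring
        _ ≤ 2 * t * ((2 * n - 2 * t - 1) * b) := mul_le_mul_of_nonneg_left h2 (by linarith)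
    have h4 : ((θ - 2 * t + 2) * (θ - 1)) * b ≤ (2 * t * (2 * n - 2 * t - 1)) * b := by
      linarith
    have h5 := le_of_mul_le_mul_right h4 hb
    linarith
  refine ⟨by linarith, ?_, hquad⟩
  by_contra! hcon
  -- the quadratic is increasing in `θ` beyond `3n/5` and exceeds the bound there
  have h6 : 0 ≤ (θ - 3 / 5 * n) * (θ + 3 / 5 * n - 2 * t + 1) :=
    mul_nonneg (by linarith) (by linarith)
  nlinarith [mul_nonneg (by linarith : (0 : ℝ) ≤ n - 14 * t - 10) (by linarith : (0 : ℝ) ≤ n),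
    mul_nonneg (by linarith : (0 : ℝ) ≤ n - 14 * t - 10) (by linarith : (0 : ℝ) ≤ t)]

/-- Moving `s - 1` vertices to the separating set increases the quadratic form at the Perron
vector of the extremal graph, as long as `s ≤ n / 4`. -/
theorem small_separator_gain {n t s b c θ : ℝ} (ht : 2 ≤ t) (hn : 14 * t + 10 ≤ n)
    (hsn : 4 * s ≤ n) (hb : 0 < b) (hc : 0 < c) (h1 : 2 * t * c ≤ θ * b) (h2 : θ ≤ 3 / 5 * n)
    (h3 : θ ^ 2 - (2 * t - 1) * θ + (2 * t - 2) ≤ 2 * t * (2 * n - 2 * t - 1)) :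
    0 < 2 * (s - 2) * b ^ 2 + 4 * (n - 2 * s - t + 1) * b ^ 2 - t * (b + c) ^ 2 := by
  have h4 : 4 * t * (t * (b + c) ^ 2) ≤ (2 * t + θ) ^ 2 * b ^ 2 := by
    have h5 : (2 * t * (b + c)) ^ 2 ≤ ((2 * t + θ) * b) ^ 2 :=
      pow_le_pow_left₀ (by positivity) (by linarith) 2
    linarith
  have h6 : (2 * t + θ) ^ 2 < 4 * t * (2 * (s - 2) + 4 * (n - 2 * s - t + 1)) := by
    nlinarith [mul_nonneg (by linarith : (0 : ℝ) ≤ n - 14 * t - 10) (by linarith : (0 : ℝ) ≤ t),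
      mul_nonneg (by linarith : (0 : ℝ) ≤ n - 4 * s) (by linarith : (0 : ℝ) ≤ t),
      mul_nonneg (by linarith : (0 : ℝ) ≤ 3 / 5 * n - θ) (by linarith : (0 : ℝ) ≤ 6 * t - 1)]
  have h7 := mul_lt_mul_of_pos_right h6 (pow_pos hb 2)
  have h8 : 0 < 4 * t * (2 * (s - 2) * b ^ 2 + 4 * (n - 2 * s - t + 1) * b ^ 2 -
      t * (b + c) ^ 2) := by linarith
  exact pos_of_mul_pos_right h8 (by linarith)

/-- For `s ≥ n / 4` the vector with value `2` on the independent set of size `i` and `1` elsewhere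
already beats the bound on the spectral radius of the extremal graph. -/
theorem large_separator_gain {n t s i θ : ℝ} (ht : 2 ≤ t) (hn : 14 * t + 10 ≤ n)
    (hi : i = s + t - 1) (hsn : n ≤ 4 * s) (hin : s + i ≤ n) (h2 : θ ≤ 3 / 5 * n) :
    (θ + 2 * n - 3) * (n + 3 * i) < 16 * i * (i - 1) + 9 * i * s + 18 * i * (n - s - i) +
      2 * (n - i) * (n - i - 1) := by
  have h3 : (θ + 2 * n - 3) * (n + 3 * i) ≤ (3 / 5 * n + 2 * n - 3) * (n + 3 * i) :=
    mul_le_mul_of_nonneg_right (by linarith) (by linarith)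
  refine h3.trans_lt ?_
  subst hi
  -- the difference is concave in `s` on the interval `[n / 4, (n - t + 1) / 2]`
  nlinarith [mul_nonneg (by linarith : (0 : ℝ) ≤ 4 * s - n)
      (by linarith : (0 : ℝ) ≤ n - (t - 1) - 2 * s),
    mul_nonneg (by linarith : (0 : ℝ) ≤ n - 2 * s) (by linarith : (0 : ℝ) ≤ n),
    mul_nonneg (by linarith : (0 : ℝ) ≤ n - 2 * s) (by linarith : (0 : ℝ) ≤ t - 1),
    mul_nonneg (by linarith : (0 : ℝ) ≤ n - 24) (by linarith : (0 : ℝ) ≤ n),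
    mul_nonneg (by linarith : (0 : ℝ) ≤ n - 24) (by linarith : (0 : ℝ) ≤ t - 1)]

/-! ### Comparison with the extremal graph -/

theorem nonempty_iso_coneGraph {V : Type*} [Fintype V] {G : SimpleGraph V} {p : V} {I : Finset V}
    (hp : p ∉ I) {m t : ℕ} (ht : I.card = t) (hV : Fintype.card V = 1 + m + t)
    (hd : ∀ u v, (G.dist u v : ℝ) = distLower {p} I u v) :
    Nonempty (G ≃g coneGraph m t) := by
  classical
  -- the vertex classes are matched by a colouring with three colours
  set f : V → Fin 3 := fun v => if v = p then 0 else if v ∈ I then 2 else 1 with hf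
  set g : Fin 1 ⊕ (Fin m ⊕ Fin t) → Fin 3 :=
    Sum.elim (fun _ => 0) (Sum.elim (fun _ => 1) (fun _ => 2)) with hg
  have hf0 : ∀ v, f v = 0 ↔ v = p := by
    intro v
    simp only [hf]
    split_ifs <;> simp_all
  have hf2 : ∀ v, f v = 2 ↔ v ∈ I := by
    intro v
    simp only [hf]
    split_ifs with h1 <;> simp_all
  have hf1 : ∀ v, f v = 1 ↔ v ∉ insert p I := by
    intro v
    simp only [hf, Finset.mem_insert]
    split_ifs with h1 <;> simp_all
  have hcard : ∀ c, Fintype.card {v // f v = c} = Fintype.card {x // g x = c} := by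
    intro c
    rw [Fintype.card_subtype, Fintype.card_subtype]
    have hgc : (Finset.univ.filter fun x => g x = c).card =
        (if c = 0 then 1 else 0) + (if c = 1 then m else 0) + (if c = 2 then t else 0) := by
      rw [Finset.card_filter, Fintype.sum_sum_type, Fintype.sum_sum_type]
      fin_cases c <;> simp [hg]
    rw [hgc]
    fin_cases c
    · have : (Finset.univ.filter fun v => f v = 0) = {p} := by
        ext v
        simp [hf0]
      simp [this]
    · have : (Finset.univ.filter fun v => f v = 1) = (insert p I)ᶜ := by
        ext v
        simp only [Finset.mem_filter, Finset.mem_univ, true_and, Finset.mem_compl]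
        exact hf1 v
      have h2 : (insert p I).card = t + 1 := by rw [Finset.card_insert_of_notMem hp, ht]
      have h3 : (insert p I)ᶜ.card = m := by
        rw [Finset.card_compl, h2, hV]
        omega
      simpa [this] using h3
    · simp [hf2, ht]
  set e : V ≃ Fin 1 ⊕ (Fin m ⊕ Fin t) :=
    Equiv.ofFiberEquiv (f := f) (g := g) fun c => Fintype.equivOfCardEq (hcard c) with he
  have heg : ∀ v, g (e v) = f v := fun v => Equiv.ofFiberEquiv_map _ v
  have hcone : ∀ x y, (coneGraph m t).Adj x y ↔
      x ≠ y ∧ (g x = 0 ∨ g y = 0 ∨ (g x ≠ 2 ∧ g y ≠ 2)) := by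
    intro x y
    rw [coneGraph_adj]
    rcases x with x | x | x <;> rcases y with y | y | y <;> simp [hg, Fin.fin_one_eq_zero]
  refine ⟨⟨e, ?_⟩⟩
  intro u v
  rw [hcone, heg, heg, hf0, hf0, Ne.eq_def (f u), Ne.eq_def (f v), hf2, hf2, e.injective.ne_iff]
  have h1 : G.Adj u v ↔ distLower {p} I u v = 1 := by
    rw [← hd, ← SimpleGraph.dist_eq_one_iff_adj]
    norm_cast
  rw [h1]
  unfold distLower
  simp only [Finset.mem_singleton]
  by_cases huv : u = v
  · simp [huv]
  · by_cases hu : u = p <;> by_cases hv : v = p <;> by_cases hui : u ∈ I <;>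
      by_cases hvi : v ∈ I <;> simp_all

/-- Among the connected graphs with an independent set that exceeds by `k` a set containing all its
neighbours, only the extremal graph has a spectral radius at most that of the extremal graph. -/
theorem nonempty_iso_coneGraph_of_eta_le {V : Type*} [Fintype V] {G : SimpleGraph V}
    (hG : G.Connected) {k : ℕ} (hk : 1 ≤ k) (hn : 14 * k + 24 ≤ Fintype.card V)
    (hη : eta G ≤ eta (coneGraph (Fintype.card V - 2 - k) (1 + k))) {S I : Finset V}
    (hS : 1 ≤ S.card) (hI : I.card = S.card + k) (hSI : Disjoint S I)
    (hN : ∀ u ∈ I, ∀ v, G.Adj u v → v ∈ S) :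
    Nonempty (G ≃g coneGraph (Fintype.card V - 2 - k) (1 + k)) := by
  classical
  have := hG.nonempty
  obtain ⟨a, b, c, ha, hb, hc, e1, e2, e3⟩ :=
    exists_coneGraph_perron (Fintype.card V - 2 - k) (1 + k) (by omega) (by omega)
  set η := eta (coneGraph (Fintype.card V - 2 - k) (1 + k)) with hηdef
  obtain ⟨n, hnr⟩ : ∃ n : ℝ, (Fintype.card V : ℝ) = n := ⟨_, rfl⟩
  obtain ⟨s, hs⟩ : ∃ s : ℝ, (S.card : ℝ) = s := ⟨_, rfl⟩
  obtain ⟨t, ht⟩ : ∃ t : ℝ, ((1 + k : ℕ) : ℝ) = t := ⟨_, rfl⟩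
  obtain ⟨i, hi⟩ : ∃ i : ℝ, (I.card : ℝ) = i := ⟨_, rfl⟩
  have hm : ((Fintype.card V - 2 - k : ℕ) : ℝ) = n - 1 - t := by
    rw [← hnr, ← ht, Nat.cast_sub (by omega), Nat.cast_sub (by omega)]
    push_cast
    ring
  have hist : i = s + t - 1 := by
    rw [← hi, hI, ← hs, ← ht]
    push_cast
    ring
  have ht2 : 2 ≤ t := by
    rw [← ht]
    exact_mod_cast (by omega : 2 ≤ 1 + k)
  have hnt : 14 * t + 10 ≤ n := by
    rw [← ht, ← hnr]
    exact_mod_cast (by omega : 14 * (1 + k) + 10 ≤ Fintype.card V)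
  have hsi : s + i ≤ n := by
    have h := Finset.card_le_univ (S ∪ I)
    rw [Finset.card_union_of_disjoint hSI] at h
    rw [← hs, ← hi, ← hnr]
    exact_mod_cast h
  rw [hm, ht] at e1 e2 e3
  obtain ⟨hcb, hθ, hquad⟩ := perron_estimates (θ := η - 2 * n + 3) ht2 hnt ha hb hc
    (by linarith) (by linarith) (by linarith)
  have hray : ∀ x : V → ℝ, (∑ u, ∑ v, (G.dist u v : ℝ) * (x u + x v) ^ 2) / 2 ≤
      η * ∑ v, x v ^ 2 := fun x =>
    (rayleigh_le_eta G x).trans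
      (mul_le_mul_of_nonneg_right hη (Finset.sum_nonneg fun v _ => sq_nonneg _))
  have hlow : ∀ x : V → ℝ, (∑ u, ∑ v, distLower S I u v * (x u + x v) ^ 2) / 2 ≤
      (∑ u, ∑ v, (G.dist u v : ℝ) * (x u + x v) ^ 2) / 2 := by
    intro x
    refine div_le_div_of_nonneg_right ?_ zero_le_two
    exact Finset.sum_le_sum fun u _ => Finset.sum_le_sum fun v _ =>
      mul_le_mul_of_nonneg_right (distLower_le_dist hG hN u v) (sq_nonneg _)
  -- the quadratic form of the extremal graph at its Perron vector
  have heq : η * (a ^ 2 + (n - 1 - t) * b ^ 2 + t * c ^ 2) =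
      a * ((n - 1 - t + t) * a + (n - 1 - t) * b + t * c) +
      (n - 1 - t) * b * ((2 * (n - 1 - t) + 2 * t - 1) * b + a + 2 * t * c) +
      t * c * ((2 * (n - 1 - t) + 4 * t - 3) * c + a + 2 * (n - 1 - t) * b) := by
    rw [← e1, ← e2, ← e3]
    ring
  rcases Nat.lt_or_ge S.card 2 with hS2 | hS2
  · obtain ⟨p, rfl⟩ := Finset.card_eq_one.1 (by omega : S.card = 1)
    have hpI : p ∉ I := Finset.disjoint_left.1 hSI (Finset.mem_singleton_self p)
    have hs1 : s = 1 := by rw [← hs, Finset.card_singleton, Nat.cast_one]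
    have hit : i = t := by rw [hist, hs1]; ring
    obtain ⟨q1, q2⟩ := sum_sum_distLower_threeValued hSI (Finset.mem_singleton_self p)
      (Finset.Subset.refl I) a b c n s i t hnr hs hi (hi.trans hit)
    set x := threeValued p I a b c with hx
    have hxpos : ∀ v, 0 < x v := by
      intro v
      rw [hx]
      unfold threeValued
      split_ifs <;> assumption
    have h1 := hray x
    have h2 := hlow x
    rw [q1, heq] at h1
    rw [hs1, hit] at q2
    have hsum : ∑ u, ∑ v, distLower {p} I u v * (x u + x v) ^ 2 =
        ∑ u, ∑ v, (G.dist u v : ℝ) * (x u + x v) ^ 2 := by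
      linarith
    refine nonempty_iso_coneGraph hpI (by rw [hI, Finset.card_singleton]) (by omega) ?_
    have hle : ∀ u v, distLower {p} I u v * (x u + x v) ^ 2 ≤
        (G.dist u v : ℝ) * (x u + x v) ^ 2 := fun u v =>
      mul_le_mul_of_nonneg_right (distLower_le_dist hG hN u v) (sq_nonneg _)
    have hrow := (Finset.sum_eq_sum_iff_of_le fun u _ =>
      Finset.sum_le_sum fun v _ => hle u v).1 hsum
    intro u v
    have hent := (Finset.sum_eq_sum_iff_of_le fun v _ => hle u v).1
      (hrow u (Finset.mem_univ u)) v (Finset.mem_univ v)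
    exact (mul_right_cancel₀ (pow_pos (add_pos (hxpos u) (hxpos v)) 2).ne' hent).symm
  · exfalso
    obtain ⟨p, hp⟩ := Finset.card_pos.1 hS
    have hs2 : 2 ≤ s := by
      rw [← hs]
      exact_mod_cast hS2
    rcases le_total (4 * s) n with hsn | hsn
    · obtain ⟨J, hJI, hJ⟩ := Finset.exists_subset_card_eq (by omega : 1 + k ≤ I.card)
      obtain ⟨q1, q2⟩ := sum_sum_distLower_threeValued hSI hp hJI a b c n s i t hnr hs hi
        (by rw [hJ, ht])
      have h1 := (hlow _).trans (hray (threeValued p J a b c))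
      rw [q1, q2, heq] at h1
      have hgain := small_separator_gain ht2 hnt hsn hb hc hcb hθ hquad
      have h3 := mul_pos (by linarith : 0 < s - 1) hgain
      rw [hist] at h1
      linarith
    · obtain ⟨q1, q2⟩ := sum_sum_distLower_threeValued hSI hp (Finset.Subset.refl I) 1 1 2 n s i i
        hnr hs hi hi
      have h1 := (hlow _).trans (hray (threeValued p I 1 1 2))
      rw [q1, q2] at h1
      have hgain := large_separator_gain ht2 hnt hist hsn hsi hθ
      linarith

/-- The central vertex with weight `1` and the clique with weights `1 / 2` form a fractional vertex
cover of the extremal graph. -/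
theorem fractionalMatchingNumber_le_of_iso {V : Type*} [Fintype V] {G : SimpleGraph V} {m t : ℕ}
    (φ : G ≃g coneGraph m t) : fractionalMatchingNumber G ≤ 1 + (m : ℝ) / 2 := by
  set w : Fin 1 ⊕ (Fin m ⊕ Fin t) → ℝ :=
    Sum.elim (fun _ => 1) (Sum.elim (fun _ => 1 / 2) (fun _ => 0)) with hw
  have hw0 : ∀ x, 0 ≤ w x := by
    rintro (x | x | x) <;> simp [hw]
  refine (fractionalMatchingNumber_le_of_cover G (fun v => w (φ v)) (fun v => hw0 _) ?_).trans ?_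
  · intro u v huv
    have h := φ.map_adj_iff.2 huv
    generalize φ u = x at h ⊢
    generalize φ v = y at h ⊢
    rw [coneGraph_adj] at h
    rcases h with ⟨-, rfl | rfl | ⟨i, j, rfl, rfl⟩⟩
    · have := hw0 y
      simp only [hw, Sum.elim_inl] at this ⊢
      linarith
    · have := hw0 x
      simp only [hw, Sum.elim_inl] at this ⊢
      linarith
    · norm_num [hw]
  · rw [show ∑ v, w (φ v) = ∑ x, w x from φ.toEquiv.sum_comp w, Fintype.sum_sum_type, Fintype.sum_sum_type]
    simp [hw, div_eq_mul_inv]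

end DistSignless

end

theorem theorem1 {V : Type*} [Fintype V] (G : SimpleGraph V) (hconn : G.Connected)
    (n k : ℕ) (hV : Fintype.card V = n) (hk : 1 ≤ k) (hkn : k < n) (hn : 14 * k + 24 ≤ n)
    (hη : DistSignless.eta G ≤ DistSignless.eta (DistSignless.coneGraph (n - 2 - k) (1 + k))) :
    ((n : ℝ) - k) / 2 < DistSignless.fractionalMatchingNumber G ↔
      ¬ Nonempty (G ≃g DistSignless.coneGraph (n - 2 - k) (1 + k)) := by
  subst hV
  constructor
  · rintro hlt ⟨φ⟩
    have h := DistSignless.fractionalMatchingNumber_le_of_iso φ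
    rw [Nat.cast_sub (by omega), Nat.cast_sub (by omega)] at h
    push_cast at h
    linarith
  · intro hiso
    by_contra! hle
    obtain ⟨S, I, hS, hI, hSI, hN⟩ :=
      DistSignless.exists_independent_of_fractionalMatchingNumber_le G hconn k hk (by omega) hle
    exact hiso (DistSignless.nonempty_iso_coneGraph_of_eta_le hconn hk hn hη hS hI hSI hN)
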